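/- Let $G$ be a countable abelian group acting by (topological) automorphisms $\alpha_g$, $g\in G$, on a compact metrizable abelian group $X$. The action is called expansive if there is a neighbourhood $N$ of $0$ in $X$ with $\bigcap_{g\in G}\alpha_g(N)=\{0\}$. The Pontryagin dual $M=\widehat X$ is regarded as a module over the group ring $\mathbb{Z}[G]$ by $$\Big(\sum_{g\in G}c_g\,g\Big)\cdot\chi=\sum_{g\in G}c_g\,(\chi\circ\alpha_g)\qquad(\chi\in\widehat X).$$ For $a\in M$ write $\operatorname{ann}(a)=\{f\in\mathbb{Z}[G]: f\cdot a=0\}$, and for an ideal $\mathfrak a$ of $\mathbb{Z}[G]$ write $\overline G$ for the image of $G$ in $\mathbb{Z}[G]/\mathfrak a$. Let $S\subseteq M$ be any (finite or infinite) set that generates $M$ as a $\mathbb{Z}[G]$-module. Then the action is expansive if and only if both of the following hold: (i) $M$ is a finitely generated $\mathbb{Z}[G]$-module; (ii) for no $a\in S$ is there a unital ring homomorphism $\phi:\mathbb{Z}[G]/\operatorname{ann}(a)\to\mathbb{C}$ for which $\phi(\overline G)$ is a subgroup of the unit circle $\{z\in\mathbb{C}:|z|=1\}$. -/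

import Mathlib

open Topology

namespace AlgebraicAction

section Expansive

variable (G X : Type*) [CommGroup G] [CommGroup X] [TopologicalSpace X] [MulDistribMulAction G X]

/-- An action of `G` by automorphisms `α_g : x ↦ g • x` of the topological group `X` (written
multiplicatively, with neutral element `1`) is expansive if there is a neighbourhood `N` of the
neutral element such that the intersection of all the sets `α_g(N)` is trivial. -/
def IsExpansive : Prop :=
  ∃ N ∈ 𝓝 (1 : X), ⋂ g : G, (fun x : X => g • x) '' N = {1}

end Expansive

section Dual

variable (G X : Type*) [CommGroup G] [CommGroup X] [TopologicalSpace X]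
  [MulDistribMulAction G X] [ContinuousConstSMul G X]

/-- The automorphism `α_g : x ↦ g • x` as a continuous homomorphism. -/
def actionHom (g : G) : X →ₜ* X where
  toMonoidHom := MulDistribMulAction.toMonoidHom X g
  continuous_toFun := continuous_const_smul g

/-- The dual action of `G` on the group of characters of `X`, written additively: the element `g`
sends the character `χ` to `χ ∘ α_g`. This is multiplicative in `g` because `G` is abelian. -/
noncomputable def dualRep : Representation ℤ G (Additive (PontryaginDual X)) where
  toFun g := (MonoidHom.toAdditive
    (PontryaginDual.map (actionHom G X g)).toMonoidHom).toIntLinearMap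
  map_one' := by
    refine LinearMap.ext fun χ => ?_
    refine Additive.toMul.injective (PontryaginDual.ext fun x => ?_)
    exact congrArg (fun y => χ.toMul y) (one_smul G x)
  map_mul' g h := by
    refine LinearMap.ext fun χ => ?_
    refine Additive.toMul.injective (PontryaginDual.ext fun x => ?_)
    refine congrArg (fun y => χ.toMul y) (?_ : (g * h) • x = h • g • x)
    rw [mul_comm, mul_smul]

/-- The defining formula of the dual action. -/
theorem dualRep_apply (g : G) (χ : Additive (PontryaginDual X)) (x : X) :
    (dualRep G X g χ).toMul x = χ.toMul (g • x) := rfl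

/-- The Pontryagin dual `M` of `X`, as a module over the group ring `ℤ[G]` through
`(∑ c_g g) • χ = ∑ c_g (χ ∘ α_g)`. -/
abbrev DualModule : Type _ := (dualRep G X).asModule

end Dual

section Points

variable {G : Type*} [CommGroup G]

/-- The image of `G` in the quotient ring `ℤ[G] / I`. -/
def groupImage (I : Ideal (MonoidAlgebra ℤ G)) : Set (MonoidAlgebra ℤ G ⧸ I) :=
  Set.range fun g : G => Ideal.Quotient.mk I (MonoidAlgebra.of ℤ G g)

/-- There is a (unital) ring homomorphism `φ : ℤ[G] / I → ℂ` for which the image under `φ` of the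
image of `G` in `ℤ[G] / I` is a subgroup of the unit circle. -/
def HasUnitaryPoint (I : Ideal (MonoidAlgebra ℤ G)) : Prop :=
  ∃ φ : (MonoidAlgebra ℤ G ⧸ I) →+* ℂ, ∃ H : Subgroup Circle,
    φ '' groupImage I = (fun z : Circle => (z : ℂ)) '' (H : Set Circle)

end Points

end AlgebraicAction

set_option linter.unusedSectionVars false

/-! By compactness and duality, expansiveness means that finitely many characters `F` and some `ε`
force `x = 1` whenever the orbit of `x` stays `ε`-close to `1` along `F` (`isExpansive_iff`). The
submodule generated by such an `F` separates points, so it is all of `M`: hence (i).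

If a unitary `φ` kills `ann(a)`, Nakayama's lemma at the prime `ker φ` yields a nonzero additive `η
: M → ℂ` with `η (r • m) = φ r * η m` (`exists_equivariant_addMonoidHom`). A small multiple of the
real part of a rotation of `η`, exponentiated, is a character of `M`, hence a point of `X`. As
`|φ(g)| = 1`, its whole orbit stays near `1`, yet the point is nontrivial.

Conversely, for finite `M` the support is both `V(ann M)` and the union of the `V(ann a)`, `a ∈ S`,
so (ii) leaves no unitary point on `ann M` (`exists_torsionOf_le_ker`). Gelfand theory for the
translations of bounded functions on `G` then gives finitely many elements of `ann M` with no common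
nonzero bounded solution (`exists_finset_injective`). If an orbit is close to `1` along generators
of `M`, its arguments form such a solution: the relations, a priori valid modulo `2π`, hold exactly
for small arguments. So the arguments vanish and `x = 1`.

The duality needed for `X` is proved by Gelfand theory of the convolution algebra (separation of
points) and by Stone–Weierstrass with the Haar mean (`mem_of_separatesPoints`,
`exists_forall_apply_eq`). -/

namespace AlgebraicAction

/-! ### Gelfand theory for commuting elements of a Banach algebra. -/

section BanachAlgebra

variable {B : Type*} [NormedRing B] [NormedAlgebra ℂ B] [CompleteSpace B]

theorem mem_adjoin_of_mem {s : Set B} {a : B} (ha : a ∈ s) : a ∈ Algebra.adjoin ℂ s :=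
  Algebra.subset_adjoin ha

/-- The closed subalgebra generated by a set of pairwise commuting elements of a Banach algebra is
a commutative Banach algebra. -/
abbrev closedAdjoinNormedCommRing {s : Set B} (hs : ∀ a ∈ s, ∀ b ∈ s, a * b = b * a) :
    NormedCommRing (Algebra.adjoin ℂ s).topologicalClosure :=
  { (inferInstance : NormedRing (Algebra.adjoin ℂ s).topologicalClosure) with
    mul_comm := ((Algebra.adjoin ℂ s).commRingTopologicalClosure fun a b =>
      (Algebra.isMulCommutative_adjoin ℂ hs).is_comm.comm a b).mul_comm }

/-- A bounded character of a subalgebra of a Banach algebra, as a function on the whole algebra. -/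
structure IsBoundedCharacterOn (A : Subalgebra ℂ B) (χ : B → ℂ) : Prop where
  map_one : χ 1 = 1
  map_mul : ∀ a ∈ A, ∀ b ∈ A, χ (a * b) = χ a * χ b
  map_add : ∀ a ∈ A, ∀ b ∈ A, χ (a + b) = χ a + χ b
  map_smul : ∀ (c : ℂ), ∀ a ∈ A, χ (c • a) = c * χ a
  exists_bound : ∃ C : ℝ, ∀ a ∈ A, ‖χ a‖ ≤ C * ‖a‖

/-- A character of the closed subalgebra generated by a set restricts to a bounded character. -/
theorem exists_isBoundedCharacterOn {s : Set B}
    (ψ : (Algebra.adjoin ℂ s).topologicalClosure →ₐ[ℂ] ℂ) :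
    ∃ χ : B → ℂ, IsBoundedCharacterOn (Algebra.adjoin ℂ s) χ ∧
      ∀ b (hb : b ∈ Algebra.adjoin ℂ s), χ b = ψ ⟨b, Subalgebra.le_topologicalClosure _ hb⟩ := by
  classical
  have : CompleteSpace (Algebra.adjoin ℂ s).topologicalClosure :=
    (Subalgebra.isClosed_topologicalClosure _).completeSpace_coe
  -- The value `0` off the subalgebra is junk.
  let χ : B → ℂ := fun b => if hb : b ∈ Algebra.adjoin ℂ s then
    ψ ⟨b, Subalgebra.le_topologicalClosure _ hb⟩ else 0
  have hχ : ∀ b (hb : b ∈ Algebra.adjoin ℂ s),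
      χ b = ψ ⟨b, Subalgebra.le_topologicalClosure _ hb⟩ := fun b hb => dif_pos hb
  refine ⟨χ, ⟨?_, fun a ha b hb => ?_, fun a ha b hb => ?_, fun c a ha => ?_,
    ⟨‖(1 : B)‖, fun a ha => ?_⟩⟩, hχ⟩
  · rw [hχ 1 (one_mem _), ← map_one ψ]
    rfl
  · rw [hχ _ (mul_mem ha hb), hχ a ha, hχ b hb, ← map_mul]
    rfl
  · rw [hχ _ (add_mem ha hb), hχ a ha, hχ b hb, ← map_add]
    rfl
  · rw [hχ _ (Subalgebra.smul_mem _ ha c), hχ a ha, ← smul_eq_mul, ← map_smul]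
    rfl
  · rw [mul_comm, hχ a ha]
    exact AlgHom.norm_apply_le_self_mul_norm_one ψ _

/-- In a Banach algebra, if no bounded character of the subalgebra generated by a commuting set
`s` vanishes on the part of a set `t` that lies in it, then `t` generates the unit left ideal. -/
theorem exists_isBoundedCharacterOn_or_span_eq_top {s t : Set B}
    (hs : ∀ a ∈ s, ∀ b ∈ s, a * b = b * a) :
    (∃ χ : B → ℂ, IsBoundedCharacterOn (Algebra.adjoin ℂ s) χ ∧
      ∀ b ∈ Algebra.adjoin ℂ s, b ∈ t → χ b = 0) ∨ Ideal.span t = ⊤ := by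
  let := closedAdjoinNormedCommRing hs
  let : NormedAlgebra ℂ (Algebra.adjoin ℂ s).topologicalClosure :=
    { Subalgebra.algebra _ with
      norm_smul_le := fun r x => norm_smul_le r (x : B) }
  have : CompleteSpace (Algebra.adjoin ℂ s).topologicalClosure :=
    (Subalgebra.isClosed_topologicalClosure _).completeSpace_coe
  let J : Ideal (Algebra.adjoin ℂ s).topologicalClosure := Ideal.span (Subtype.val ⁻¹' t)
  by_cases hJ : J = ⊤
  · right
    have h1 : (1 : (Algebra.adjoin ℂ s).topologicalClosure) ∈ J := hJ ▸ Submodule.mem_top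
    rw [Ideal.eq_top_iff_one]
    have : ∀ x ∈ J, (x : B) ∈ Ideal.span t := by
      intro x hx
      induction hx using Submodule.span_induction with
      | mem x hx => exact Ideal.subset_span hx
      | zero => exact Ideal.zero_mem _
      | add x y _ _ hx hy => exact Ideal.add_mem _ hx hy
      | smul a x _ hx => exact Ideal.mul_mem_left _ (a : B) hx
    exact this 1 h1
  · left
    obtain ⟨I, hI, hJI⟩ := J.exists_le_maximal hJ
    obtain ⟨χ, hC, hχ⟩ := exists_isBoundedCharacterOn
      (WeakDual.CharacterSpace.equivAlgHom I.toCharacterSpace)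
    refine ⟨χ, hC, fun b hb hbt => ?_⟩
    rw [hχ b hb]
    exact I.toCharacterSpace_apply_eq_zero_of_mem (hJI (Ideal.subset_span hbt))

/-- In a Banach algebra, an element of the subalgebra generated by a commuting set whose powers
do not decay faster than exponentially is not annihilated by all bounded characters. -/
theorem exists_isBoundedCharacterOn_ne_zero {s : Set B}
    (hs : ∀ a ∈ s, ∀ b ∈ s, a * b = b * a) {a : B} (has : a ∈ Algebra.adjoin ℂ s) {c r : ℝ} (hc : 0 < c)
    (hr : 0 < r) (ha : ∀ n : ℕ, c * r ^ n ≤ ‖a ^ n‖) :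
    ∃ χ : B → ℂ, IsBoundedCharacterOn (Algebra.adjoin ℂ s) χ ∧ χ a ≠ 0 := by
  let := closedAdjoinNormedCommRing hs
  let : NormedAlgebra ℂ (Algebra.adjoin ℂ s).topologicalClosure :=
    { Subalgebra.algebra _ with
      norm_smul_le := fun r x => norm_smul_le r (x : B) }
  have : CompleteSpace (Algebra.adjoin ℂ s).topologicalClosure :=
    (Subalgebra.isClosed_topologicalClosure _).completeSpace_coe
  let a' : (Algebra.adjoin ℂ s).topologicalClosure := ⟨a, Subalgebra.le_topologicalClosure _ has⟩
  by_contra! H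
  have hspec : spectralRadius ℂ a' = 0 := by
    rw [spectralRadius]
    simp only [ENNReal.iSup_eq_zero]
    intro k hk
    obtain ⟨f, hf⟩ := WeakDual.CharacterSpace.mem_spectrum_iff_exists.1 hk
    obtain ⟨χ, hC, hχ⟩ := exists_isBoundedCharacterOn (WeakDual.CharacterSpace.equivAlgHom f)
    have h0 := H χ hC
    rw [hχ a has] at h0
    have : k = 0 := hf ▸ h0
    simp [this]
  have hlim := spectrum.pow_norm_pow_one_div_tendsto_nhds_spectralRadius a'
  rw [hspec] at hlim
  -- Spectral radius zero gives `‖a ^ n‖ ≤ (r / 4) ^ n` eventually, so the rescaled norms are at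
  -- most `2⁻ⁿ`, whereas the growth hypothesis bounds them below by `c`.
  have hlim' : Filter.Tendsto (fun n : ℕ => (2 / r : ℝ) ^ n * ‖a ^ n‖) Filter.atTop (𝓝 0) := by
    have hev : ∀ᶠ n : ℕ in Filter.atTop, ENNReal.ofReal (‖a' ^ n‖ ^ (1 / n : ℝ)) <
        ENNReal.ofReal (r / 4) := hlim.eventually_lt_const (by simpa using hr)
    refine squeeze_zero' (Filter.Eventually.of_forall fun n => by positivity) ?_
      (tendsto_pow_atTop_nhds_zero_of_lt_one (r := (1 / 2 : ℝ)) (by norm_num) (by norm_num))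
    filter_upwards [hev, Filter.eventually_gt_atTop 0] with n hn hn0
    rw [ENNReal.ofReal_lt_ofReal_iff (by positivity)] at hn
    have h1 : ‖a ^ n‖ ≤ (r / 4) ^ n := by
      have h2 : (‖a' ^ n‖ ^ (1 / n : ℝ)) ^ n ≤ (r / 4) ^ n :=
        pow_le_pow_left₀ (by positivity) hn.le n
      rw [one_div, Real.rpow_inv_natCast_pow (norm_nonneg _) hn0.ne'] at h2
      exact h2
    calc (2 / r : ℝ) ^ n * ‖a ^ n‖ ≤ (2 / r) ^ n * (r / 4) ^ n := by gcongr
      _ = (1 / 2) ^ n := by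
        rw [← mul_pow]; congr 1; field_simp; norm_num
  have : ∀ n : ℕ, c ≤ (2 / r : ℝ) ^ n * ‖a ^ n‖ := fun n => by
    calc c ≤ c * 2 ^ n := le_mul_of_one_le_right hc.le (one_le_pow₀ (by norm_num))
      _ = (2 / r : ℝ) ^ n * (c * r ^ n) := by rw [div_pow]; field_simp
      _ ≤ _ := by gcongr; exact ha n
  exact absurd (ge_of_tendsto' hlim' this) (not_le.2 hc)

end BanachAlgebra

open MeasureTheory

/-- A continuous function on a compact space is integrable for a probability measure. -/
theorem integrable_of_continuous_compact {Y : Type*} [TopologicalSpace Y] [CompactSpace Y] [T2Space Y]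
    [MeasurableSpace Y] [OpensMeasurableSpace Y] (ν : Measure Y) [IsFiniteMeasure ν]
    {f : Y → ℂ} (hf : Continuous f) : Integrable f ν := by
  rw [← integrableOn_univ]
  exact hf.continuousOn.integrableOn_compact isCompact_univ

/-! ### Translation of continuous functions. -/

section Translate

variable {X : Type*} [CommGroup X] [TopologicalSpace X] [IsTopologicalGroup X]

/-- The translate of a continuous function. -/
noncomputable def translate (x : X) (f : C(X, ℂ)) : C(X, ℂ) := f.comp (ContinuousMap.mulLeft x)

theorem translate_apply (x : X) (f : C(X, ℂ)) (y : X) : translate x f y = f (x * y) := rfl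

theorem continuous_translate [CompactSpace X] (f : C(X, ℂ)) : Continuous fun x : X => translate x f :=
  (ContinuousMap.curry ⟨fun p : X × X => f (p.1 * p.2), by fun_prop⟩).continuous

theorem translate_translate (x y : X) (f : C(X, ℂ)) :
    translate x (translate y f) = translate (x * y) f := by
  ext z
  simp only [translate_apply]
  congr 1
  rw [mul_left_comm, mul_assoc]

end Translate

/-! ### The convolution algebra of a compact abelian group and its characters. -/

section Convolution

variable {X : Type*} [CommGroup X] [TopologicalSpace X] [IsTopologicalGroup X] [CompactSpace X]
  [T2Space X] [SecondCountableTopology X] [MeasurableSpace X] [BorelSpace X]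
  (μ : Measure X) [IsProbabilityMeasure μ]

/-- The convolution of two continuous functions on a compact abelian group. -/
noncomputable def conv (f g : C(X, ℂ)) : C(X, ℂ) where
  toFun x := ∫ y, f (x / y) * g y ∂μ
  continuous_toFun := by
    have := continuous_parametric_integral_of_continuous (μ := μ) (s := Set.univ)
      (f := fun x y : X => f (x / y) * g y) (by unfold Function.uncurry; fun_prop) isCompact_univ
    simpa using this

theorem conv_apply (f g : C(X, ℂ)) (x : X) : conv μ f g x = ∫ y, f (x / y) * g y ∂μ := rfl

theorem norm_conv_le (f g : C(X, ℂ)) : ‖conv μ f g‖ ≤ ‖f‖ * ‖g‖ := by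
  rw [ContinuousMap.norm_le _ (by positivity)]
  intro x
  rw [conv_apply]
  refine (norm_integral_le_of_norm_le_const (C := ‖f‖ * ‖g‖) 
    (Filter.Eventually.of_forall fun y => ?_)).trans ?_
  · rw [norm_mul]
    exact mul_le_mul (f.norm_coe_le_norm _) (g.norm_coe_le_norm _) (norm_nonneg _) (norm_nonneg _)
  · simp

theorem conv_add (f g h : C(X, ℂ)) : conv μ f (g + h) = conv μ f g + conv μ f h := by
  ext x
  simp only [conv_apply, ContinuousMap.add_apply, mul_add]
  exact integral_add (integrable_of_continuous_compact μ (by fun_prop))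
    (integrable_of_continuous_compact μ (by fun_prop))

theorem conv_smul (c : ℂ) (f g : C(X, ℂ)) : conv μ f (c • g) = c • conv μ f g := by
  ext x
  simp only [conv_apply, ContinuousMap.smul_apply, smul_eq_mul, mul_left_comm _ c]
  exact integral_const_mul c _

/-- Convolution by a continuous function, as an operator on continuous functions. -/
noncomputable def convOp (f : C(X, ℂ)) : C(X, ℂ) →L[ℂ] C(X, ℂ) :=
  LinearMap.mkContinuous
    { toFun := conv μ f
      map_add' := conv_add μ f
      map_smul' := fun c g => conv_smul μ c f g } ‖f‖ (norm_conv_le μ f)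

theorem convOp_apply (f g : C(X, ℂ)) : convOp μ f g = conv μ f g := rfl

theorem norm_convOp_le (f : C(X, ℂ)) : ‖convOp μ f‖ ≤ ‖f‖ :=
  LinearMap.mkContinuous_norm_le _ (norm_nonneg _) _

variable [μ.IsHaarMeasure]

theorem conv_comm (f g : C(X, ℂ)) : conv μ f g = conv μ g f := by
  ext x
  rw [conv_apply, conv_apply, ← integral_div_left_eq_self _ μ x]
  simp [mul_comm]

theorem conv_assoc (f g h : C(X, ℂ)) : conv μ (conv μ f g) h = conv μ f (conv μ g h) := by
  ext x
  simp only [conv_apply]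
  calc ∫ z, (∫ y, f (x / z / y) * g y ∂μ) * h z ∂μ
      = ∫ z, (∫ y, f (x / y) * (g (y / z) * h z) ∂μ) ∂μ := by
        congr 1; ext z
        rw [← integral_mul_const, ← integral_div_right_eq_self _ z]
        congr 1; ext y
        rw [div_div_div_cancel_right, mul_assoc]
    _ = ∫ y, (∫ z, f (x / y) * (g (y / z) * h z) ∂μ) ∂μ :=
        integral_integral_swap (integrable_of_continuous_compact _
          (by unfold Function.uncurry; fun_prop))
    _ = _ := by simp only [integral_const_mul]

/-- The convolution algebra need not have a unit; this places it inside the unital Banach algebra of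
operators on `C(X, ℂ)`. -/
theorem convOp_mul_convOp (f g : C(X, ℂ)) : convOp μ f * convOp μ g = convOp μ (conv μ f g) := by
  ext1 h
  exact (conv_assoc μ f g h).symm

/-- With `conv_translate_right`, a translation can be moved from one factor to the other; this is
what turns characters of the convolution algebra into characters of `X`. -/
theorem conv_translate_left (x : X) (f g : C(X, ℂ)) :
    conv μ (translate x f) g = translate x (conv μ f g) := by
  ext y
  simp only [conv_apply, translate_apply, mul_div_assoc]

theorem conv_translate_right (x : X) (f g : C(X, ℂ)) :
    conv μ f (translate x g) = translate x (conv μ f g) := by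
  rw [conv_comm, conv_translate_left, conv_comm]

/-- The involution of the convolution algebra. -/
noncomputable def involution (f : C(X, ℂ)) : C(X, ℂ) :=
  ⟨fun x => star (f x⁻¹), by fun_prop⟩

/-- The inner product of two continuous functions. -/
noncomputable def innerL2 (f g : C(X, ℂ)) : ℂ := ∫ x, star (f x) * g x ∂μ

/-- By Fubini, the adjoint of convolution by `f` is convolution by its involution, so hermitian
functions act symmetrically. -/
theorem innerL2_conv (f g h : C(X, ℂ)) :
    innerL2 μ (conv μ f g) h = innerL2 μ g (conv μ (involution f) h) := by
  simp only [innerL2, conv_apply]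
  calc ∫ x, star (∫ y, f (x / y) * g y ∂μ) * h x ∂μ
      = ∫ x, (∫ y, star (g y) * (star (f (x / y)) * h x) ∂μ) ∂μ := by
        congr 1; ext x
        rw [Complex.star_def, ← integral_conj, ← integral_mul_const]
        congr 1; ext y
        simp only [map_mul]
        ring
    _ = ∫ y, (∫ x, star (g y) * (star (f (x / y)) * h x) ∂μ) ∂μ :=
        integral_integral_swap (integrable_of_continuous_compact _
          (by unfold Function.uncurry; fun_prop))
    _ = _ := by simp only [integral_const_mul, involution, ContinuousMap.coe_mk, inv_div]

theorem innerL2_self_pos {f : C(X, ℂ)} (hf : f ≠ 0) : 0 < (innerL2 μ f f).re := by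
  have h : innerL2 μ f f = ((∫ x, ‖f x‖ ^ 2 ∂μ : ℝ) : ℂ) := by
    rw [innerL2, ← integral_complex_ofReal]
    congr 1; ext x
    rw [Complex.star_def, mul_comm, Complex.mul_conj']
    simp
  rw [h, Complex.ofReal_re]
  obtain ⟨x, hx⟩ : ∃ x, f x ≠ 0 := by
    by_contra! H
    exact hf (ContinuousMap.ext H)
  refine Continuous.integral_pos_of_hasCompactSupport_nonneg_nonzero (x := x) (by fun_prop)
    (HasCompactSupport.of_compactSpace _) (fun x => by positivity) ?_
  simpa using hx

theorem norm_innerL2_le (f g : C(X, ℂ)) : ‖innerL2 μ f g‖ ≤ ‖f‖ * ‖g‖ := by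
  refine (norm_integral_le_of_norm_le_const (C := ‖f‖ * ‖g‖) 
    (Filter.Eventually.of_forall fun y => ?_)).trans ?_
  · rw [norm_mul, norm_star]
    exact mul_le_mul (f.norm_coe_le_norm _) (g.norm_coe_le_norm _) (norm_nonneg _) (norm_nonneg _)
  · simp

theorem norm_innerL2_sq_le (f g : C(X, ℂ)) :
    ‖innerL2 μ f g‖ ^ 2 ≤ (innerL2 μ f f).re * (innerL2 μ g g).re := by
  have key : ∀ f g : C(X, ℂ), innerL2 μ f g =
      inner ℂ (ContinuousMap.toLp 2 μ ℂ f) (ContinuousMap.toLp 2 μ ℂ g) := by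
    intro f g
    rw [ContinuousMap.inner_toLp, innerL2]
    congr 1; ext x
    exact mul_comm _ _
  have hself : ∀ f : C(X, ℂ), (innerL2 μ f f).re = ‖ContinuousMap.toLp 2 μ ℂ f‖ ^ 2 := fun f => by
    rw [key]
    exact inner_self_eq_norm_sq (𝕜 := ℂ) _
  rw [hself, hself, key, ← mul_pow]
  exact pow_le_pow_left₀ (norm_nonneg _) (norm_inner_le_norm _ _) 2

theorem involution_involution (f : C(X, ℂ)) : involution (involution f) = f := by
  ext x
  simp [involution]

theorem involution_conv (f g : C(X, ℂ)) :
    involution (conv μ f g) = conv μ (involution f) (involution g) := by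
  ext x
  change star (∫ y, f (x⁻¹ / y) * g y ∂μ) = ∫ y, star (f (x / y)⁻¹) * star (g y⁻¹) ∂μ
  rw [Complex.star_def, ← integral_conj, ← integral_inv_eq_self _ μ]
  congr 1; ext y
  rw [map_mul]
  congr 3
  rw [inv_div, div_inv_eq_mul, div_eq_mul_inv, mul_comm]

theorem conv_involution_self_apply_one (f : C(X, ℂ)) :
    conv μ (involution f) f 1 = innerL2 μ f f := by
  rw [conv_apply, innerL2]
  congr 1; ext y
  simp [involution]

/-- The value at `1` is the squared L² norm of `f`, which is positive because Haar measure charges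
open sets. -/
theorem conv_involution_self_ne_zero {f : C(X, ℂ)} (hf : f ≠ 0) : conv μ (involution f) f ≠ 0 := by
  intro h
  have h1 := innerL2_self_pos μ hf
  rw [← conv_involution_self_apply_one, h] at h1
  simp at h1

/-- The powers of convolution by a nonzero hermitian function do not decay faster than
exponentially. -/
theorem exists_le_norm_convOp_pow {k : C(X, ℂ)} (hk : k ≠ 0) (hinv : involution k = k) :
    ∃ c r : ℝ, 0 < c ∧ 0 < r ∧ ∀ n : ℕ, c * r ^ n ≤ ‖convOp μ k ^ n‖ := by
  let u : ℕ → C(X, ℂ) := fun n => (convOp μ k ^ n) k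
  have hu : ∀ n, u (n + 1) = conv μ k (u n) := fun n => by
    simp only [u, pow_succ']
    rfl
  let b : ℕ → ℝ := fun n => (innerL2 μ (u n) (u n)).re
  -- Log-convexity: symmetry moves one factor `k` across the inner product, then Cauchy–Schwarz
  -- applies. Hence the ratios `b (n + 1) / b n` never fall below `b 1 / b 0`.
  have hb : ∀ n, b (n + 1) ^ 2 ≤ b n * b (n + 2) := fun n => by
    refine le_trans ?_ (norm_innerL2_sq_le μ (u n) (u (n + 2)))
    have h : innerL2 μ (u (n + 1)) (u (n + 1)) = innerL2 μ (u n) (u (n + 2)) := by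
      conv_lhs => rw [hu n, innerL2_conv, hinv, ← hu n, ← hu (n + 1)]
    rw [← h, ← sq_abs]
    exact pow_le_pow_left₀ (abs_nonneg _) (Complex.abs_re_le_norm _) 2
  have hb0 : 0 < b 0 := innerL2_self_pos μ (by simpa [u] using hk)
  have hb1 : 0 < b 1 := by
    refine innerL2_self_pos μ ?_
    rw [hu 0]
    have h := conv_involution_self_ne_zero μ hk
    rw [hinv] at h
    simpa [u] using h
  have hstep : ∀ n, 0 < b n ∧ b 1 / b 0 * b n ≤ b (n + 1) := by
    intro n
    induction n with
    | zero => exact ⟨hb0, by rw [div_mul_cancel₀ _ hb0.ne']⟩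
    | succ n ih =>
      obtain ⟨h0, h1⟩ := ih
      have h2 : 0 < b (n + 1) := lt_of_lt_of_le (by positivity) h1
      refine ⟨h2, ?_⟩
      have h3 : b n * (b 1 / b 0 * b (n + 1)) ≤ b n * b (n + 2) := by
        refine le_trans ?_ (hb n)
        rw [sq, ← mul_assoc, mul_comm (b n)]
        exact mul_le_mul_of_nonneg_right h1 h2.le
      exact le_of_mul_le_mul_left h3 h0
  have hgrow : ∀ n, b 0 * (b 1 / b 0) ^ n ≤ b n := by
    intro n
    induction n with
    | zero => simp
    | succ n ih =>
      refine le_trans ?_ (hstep n).2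
      rw [pow_succ', mul_left_comm]
      exact mul_le_mul_of_nonneg_left ih (by positivity)
  have hknorm : 0 < ‖k‖ := norm_pos_iff.2 hk
  -- The constants are the square root of `b 0 * (b 1 / b 0) ^ n ≤ b n ≤ (‖convOp μ k ^ n‖ * ‖k‖) ^
  -- 2`.
  refine ⟨√(b 0) / ‖k‖, √(b 1 / b 0), by positivity, by positivity, fun n => ?_⟩
  refine (pow_le_pow_iff_left₀ (by positivity) (norm_nonneg _) two_ne_zero).1 ?_
  rw [mul_pow, div_pow, Real.sq_sqrt hb0.le, ← pow_mul, mul_comm n, pow_mul,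
    Real.sq_sqrt (by positivity), div_mul_eq_mul_div, div_le_iff₀ (by positivity), ← mul_pow]
  refine (hgrow n).trans ?_
  calc b n ≤ ‖innerL2 μ (u n) (u n)‖ := Complex.re_le_norm _
    _ ≤ ‖u n‖ * ‖u n‖ := norm_innerL2_le μ _ _
    _ ≤ (‖convOp μ k ^ n‖ * ‖k‖) ^ 2 := by
      rw [← sq]
      exact pow_le_pow_left₀ (norm_nonneg _) (ContinuousLinearMap.le_opNorm _ _) 2

theorem convOp_sub (f g : C(X, ℂ)) : convOp μ (f - g) = convOp μ f - convOp μ g := by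
  ext1 u
  rw [sub_apply, convOp_apply, convOp_apply, convOp_apply, conv_comm,
    conv_comm μ f, conv_comm μ g]
  exact map_sub (convOp μ u) f g

/-- The characters of the convolution algebra separate the continuous functions. -/
theorem exists_conv_character {h : C(X, ℂ)} (hh : h ≠ 0) :
    ∃ p : C(X, ℂ) → ℂ, Continuous p ∧ (∀ f g, p (f - g) = p f - p g) ∧
      (∀ f g, p (conv μ f g) = p f * p g) ∧ p h ≠ 0 := by
  -- The growth bound is used for the hermitian function `h* ∗ h`: a character nonzero on this
  -- product is nonzero on `h`.
  obtain ⟨c, r, hc, hr, hgrow⟩ := exists_le_norm_convOp_pow μ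
    (conv_involution_self_ne_zero μ hh) (by
      rw [involution_conv, involution_involution, conv_comm])
  have hs : ∀ a ∈ Set.range (convOp μ), ∀ b ∈ Set.range (convOp μ), a * b = b * a := by
    rintro _ ⟨f, rfl⟩ _ ⟨g, rfl⟩
    rw [convOp_mul_convOp, convOp_mul_convOp, conv_comm]
  have hmem := fun f : C(X, ℂ) => mem_adjoin_of_mem (B := C(X, ℂ) →L[ℂ] C(X, ℂ))
    (s := Set.range (convOp μ)) ⟨f, rfl⟩
  obtain ⟨χ, hC, hχ⟩ := exists_isBoundedCharacterOn_ne_zero (B := C(X, ℂ) →L[ℂ] C(X, ℂ))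
    (s := Set.range (convOp μ)) (c := c) (r := r) hs (hmem (conv μ (involution h) h)) hc hr hgrow
  obtain ⟨C, hbound⟩ := hC.exists_bound
  have hsub : ∀ f g, χ (convOp μ (f - g)) = χ (convOp μ f) - χ (convOp μ g) := fun f g => by
    rw [eq_sub_iff_add_eq, ← hC.map_add _ (hmem _) _ (hmem _), convOp_sub, sub_add_cancel]
  have hmul : ∀ f g, χ (convOp μ (conv μ f g)) = χ (convOp μ f) * χ (convOp μ g) :=
    fun f g => by rw [← convOp_mul_convOp, hC.map_mul _ (hmem _) _ (hmem _)]
  refine ⟨fun f => χ (convOp μ f), ?_, hsub, hmul, fun h0 => hχ ?_⟩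
  · refine (LipschitzWith.of_dist_le_mul (K := C.toNNReal) fun f g => ?_).continuous
    rw [dist_eq_norm, dist_eq_norm, ← hsub]
    refine (hbound _ (hmem _)).trans ?_
    exact mul_le_mul (Real.le_coe_toNNReal C) (norm_convOp_le μ _) (norm_nonneg _)
      (NNReal.coe_nonneg _)
  · rw [hmul]
    exact mul_eq_zero_of_right _ h0

end Convolution

/-! ### Characters separate points. -/

section Separation

variable {X : Type*} [CommGroup X] [TopologicalSpace X] [IsTopologicalGroup X] [CompactSpace X]

/-- A continuous multiplicative complex-valued function on a compact group with value `1` at the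
neutral element takes its values in the unit circle. -/
theorem norm_eq_one_of_continuous_mul {χ : X → ℂ} (hc : Continuous χ) (h1 : χ 1 = 1)
    (hmul : ∀ x y, χ (x * y) = χ x * χ y) (x : X) : ‖χ x‖ = 1 := by
  have hpow : ∀ (x : X) (n : ℕ), χ (x ^ n) = χ x ^ n := fun x n =>
    map_pow (⟨⟨χ, h1⟩, hmul⟩ : X →* ℂ) x n
  obtain ⟨C, hC⟩ := isCompact_univ.exists_bound_of_continuousOn hc.continuousOn
  have hle : ∀ x, ‖χ x‖ ≤ 1 := by
    intro x
    by_contra! h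
    obtain ⟨n, hn⟩ := pow_unbounded_of_one_lt C h
    have := hC (x ^ n) (Set.mem_univ _)
    rw [hpow, norm_pow] at this
    linarith
  refine le_antisymm (hle x) ?_
  have h2 : ‖χ x‖ * ‖χ x⁻¹‖ = 1 := by rw [← norm_mul, ← hmul, mul_inv_cancel, h1, norm_one]
  calc 1 = ‖χ x‖ * ‖χ x⁻¹‖ := h2.symm
    _ ≤ ‖χ x‖ * 1 := mul_le_mul_of_nonneg_left (hle _) (norm_nonneg _)
    _ = ‖χ x‖ := mul_one _

/-- The characters of a second countable compact abelian group separate points. -/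
theorem exists_pontryaginDual_apply_ne_one [T2Space X] [SecondCountableTopology X] {x : X}
    (hx : x ≠ 1) : ∃ χ : PontryaginDual X, χ x ≠ 1 := by
  let _ : MeasurableSpace X := borel X
  have : BorelSpace X := ⟨rfl⟩
  let μ : Measure X := Measure.haarMeasure ⊤
  have : IsProbabilityMeasure μ := ⟨by
    have h := Measure.haarMeasure_self (G := X) (K₀ := ⊤)
    simpa using h⟩
  obtain ⟨F, hF0, hF1, -⟩ := exists_continuous_zero_one_of_isClosed (isClosed_singleton (x := (1 : X)))
    (isClosed_singleton (x := x)) (by simpa using hx.symm)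
  let f : C(X, ℂ) := ⟨fun y => (F y : ℂ), by fun_prop⟩
  have hf : translate x f - f ≠ 0 := fun h => by
    have h1 := DFunLike.congr_fun h 1
    have h2 := hF0 rfl
    have h3 := hF1 rfl
    simp [translate_apply, f, h2, h3] at h1
  obtain ⟨p, hpc, hpsub, hpmul, hp⟩ := exists_conv_character μ hf
  rw [hpsub, sub_ne_zero] at hp
  -- If `p f = 0`, moving a translation across `translate x f ∗ translate x f` leaves a factor `f`,
  -- so `p (translate x f)` vanishes too, contradicting `hp`.
  have hpf : p f ≠ 0 := by
    intro h0
    rw [h0] at hp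
    refine hp (mul_self_eq_zero.1 ?_)
    rw [← hpmul, conv_translate_left, ← conv_translate_right, hpmul, h0, zero_mul]
  let χ : X → ℂ := fun y => p (translate y f) / p f
  have hχ1 : χ 1 = 1 := by
    have : translate (1 : X) f = f := by ext y; simp [translate_apply]
    simp only [χ, this, div_self hpf]
  have hχmul : ∀ y z, χ (y * z) = χ y * χ z := by
    intro y z
    have : p (translate (y * z) f) * p f = p (translate y f) * p (translate z f) := by
      rw [← hpmul, ← hpmul, ← translate_translate, conv_translate_left, conv_translate_left,
        conv_translate_left, conv_translate_right]
    simp only [χ]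
    field_simp
    linear_combination this
  have hχc : Continuous χ := (hpc.comp (continuous_translate f)).div_const _
  have hnorm := norm_eq_one_of_continuous_mul hχc hχ1 hχmul
  let ξ : X →* Circle :=
    { toFun := fun y => ⟨χ y, mem_sphere_zero_iff_norm.2 (hnorm y)⟩
      map_one' := Subtype.ext hχ1
      map_mul' := fun y z => Subtype.ext (hχmul y z) }
  refine ⟨(⟨ξ, hχc.subtype_mk _⟩ : X →ₜ* Circle), fun h => hp ?_⟩
  have h' : χ x = 1 := congrArg (fun z : Circle => (z : ℂ)) h
  exact (div_eq_one_iff_eq hpf).1 h'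

end Separation

/-! ### Pontryagin duality by Stone–Weierstrass and the Haar mean. -/

section Duality

/-- A continuous linear functional on `C(K, ℂ)` vanishing on a self-adjoint monoid of functions
that separates points is zero. -/
theorem continuousLinearMap_eq_zero_of_separatesPoints {K : Type*} [TopologicalSpace K]
    [CompactSpace K] (N : Submonoid C(K, ℂ)) (hstar : ∀ f ∈ N, star f ∈ N)
    (hsep : ∀ x y, x ≠ y → ∃ f ∈ N, f x ≠ f y) (Φ : C(K, ℂ) →L[ℂ] ℂ) (hΦ : ∀ f ∈ N, Φ f = 0) :
    Φ = 0 := by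
  let A := StarAlgebra.adjoin ℂ (N : Set C(K, ℂ))
  have hA : A.topologicalClosure = ⊤ := by
    refine ContinuousMap.starSubalgebra_topologicalClosure_eq_top_of_separatesPoints A ?_
    intro x y hxy
    obtain ⟨f, hf, hfxy⟩ := hsep x y hxy
    exact ⟨f, ⟨f, StarAlgebra.subset_adjoin ℂ _ hf, rfl⟩, hfxy⟩
  have hzero : ∀ f ∈ A, Φ f = 0 := by
    intro f hf
    -- Since `N` is closed under products and `star`, the star subalgebra it generates is its linear
    -- span.
    have hunion : (N : Set C(K, ℂ)) ∪ star (N : Set C(K, ℂ)) = N := by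
      refine Set.union_eq_left.2 fun g hg => ?_
      simpa using hstar _ hg
    have hf' : f ∈ Subalgebra.toSubmodule (Algebra.adjoin ℂ (N : Set C(K, ℂ))) := by
      rw [← hunion, ← StarAlgebra.adjoin_toSubalgebra]
      exact hf
    clear hf
    rw [Algebra.adjoin_eq_span, Submonoid.closure_eq] at hf'
    induction hf' using Submodule.span_induction with
    | mem x hx => exact hΦ x hx
    | zero => exact map_zero Φ
    | add x y _ _ hx hy =>
      rw [map_add, hx, hy, add_zero]
    | smul c x _ hx =>
      rw [map_smul, hx, smul_zero]
  have hclosed : IsClosed {f : C(K, ℂ) | Φ f = 0} := isClosed_eq Φ.continuous continuous_const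
  ext1 f
  have hf : f ∈ closure (A : Set C(K, ℂ)) := by
    rw [← StarSubalgebra.topologicalClosure_coe, hA]
    trivial
  exact closure_minimal hzero hclosed hf

variable {X : Type*} [CommGroup X] [TopologicalSpace X] [IsTopologicalGroup X] [CompactSpace X]

/-- A compact abelian group has an invariant mean. -/
theorem exists_invariant_mean [T2Space X] [SecondCountableTopology X] :
    ∃ Λ : C(X, ℂ) →L[ℂ] ℂ, Λ 1 = 1 ∧ ∀ x f, Λ (translate x f) = Λ f := by
  let _ : MeasurableSpace X := borel X
  have : BorelSpace X := ⟨rfl⟩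
  let μ : Measure X := Measure.haarMeasure ⊤
  have : IsProbabilityMeasure μ := ⟨by
    have h := Measure.haarMeasure_self (G := X) (K₀ := ⊤)
    simpa using h⟩
  refine ⟨LinearMap.mkContinuous
    { toFun := fun f => ∫ x, f x ∂μ
      map_add' := fun f g => integral_add (integrable_of_continuous_compact μ f.continuous)
        (integrable_of_continuous_compact μ g.continuous)
      map_smul' := fun c f => integral_const_mul c _ } 1 fun f => ?_, ?_, fun x f => ?_⟩
  · refine (norm_integral_le_of_norm_le_const (C := ‖f‖)
      (Filter.Eventually.of_forall f.norm_coe_le_norm)).trans ?_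
    simp
  · change ∫ x, (1 : C(X, ℂ)) x ∂μ = 1
    simp
  · exact integral_mul_left_eq_self (fun y => f y) x

/-- A character of a topological group as a continuous complex-valued function. -/
noncomputable def charMap (χ : PontryaginDual X) : C(X, ℂ) :=
  ⟨fun x => (χ x : ℂ), continuous_subtype_val.comp (map_continuous χ)⟩

theorem charMap_apply (χ : PontryaginDual X) (x : X) : charMap χ x = (χ x : ℂ) := rfl

theorem charMap_one : charMap (1 : PontryaginDual X) = 1 := rfl

theorem charMap_mul (χ ψ : PontryaginDual X) : charMap (χ * ψ) = charMap χ * charMap ψ := by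
  ext x
  exact Circle.coe_mul _ _

theorem charMap_inv (χ : PontryaginDual X) : charMap χ⁻¹ = star (charMap χ) := by
  ext x
  exact Circle.coe_inv_eq_conj _

/-- Translation by `x` multiplies the character by `χ x`, which differs from `1` for some `x`;
invariance then forces the mean to be zero. -/
theorem invariant_mean_charMap {Λ : C(X, ℂ) →L[ℂ] ℂ} (hΛ : ∀ x f, Λ (translate x f) = Λ f)
    {χ : PontryaginDual X} (hχ : χ ≠ 1) : Λ (charMap χ) = 0 := by
  obtain ⟨x, hx⟩ : ∃ x, χ x ≠ 1 := by
    by_contra! H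
    exact hχ (PontryaginDual.ext H)
  have h : translate x (charMap χ) = (χ x : ℂ) • charMap χ := by
    ext y
    rw [translate_apply, charMap_apply, map_mul, Circle.coe_mul]
    rfl
  have h1 := hΛ x (charMap χ)
  rw [h, map_smul, smul_eq_mul] at h1
  have h2 : ((χ x : ℂ) - 1) * Λ (charMap χ) = 0 := by linear_combination h1
  refine (mul_eq_zero.1 h2).resolve_left fun h3 => hx ?_
  exact Circle.ext (sub_eq_zero.1 h3)

variable [T2Space X] [SecondCountableTopology X]

/-- A group of characters that separates points contains all characters. -/
theorem mem_of_separatesPoints (L : Subgroup (PontryaginDual X))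
    (hL : ∀ x : X, (∀ χ ∈ L, χ x = 1) → x = 1) (ψ : PontryaginDual X) : ψ ∈ L := by
  obtain ⟨Λ, hΛ1, hΛ⟩ := exists_invariant_mean (X := X)
  by_contra hψ
  let N : Submonoid C(X, ℂ) :=
    { carrier := {f | ∃ χ ∈ L, f = charMap χ}
      one_mem' := ⟨1, one_mem _, rfl⟩
      mul_mem' := by
        rintro _ _ ⟨χ, hχ, rfl⟩ ⟨ξ, hξ, rfl⟩
        exact ⟨χ * ξ, mul_mem hχ hξ, (charMap_mul _ _).symm⟩ }
  -- `Φ` is the Fourier coefficient at `ψ`: by orthogonality it kills `L` if `ψ ∉ L`, but it is `1`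
  -- at `ψ`.
  let Φ : C(X, ℂ) →L[ℂ] ℂ := Λ.comp (ContinuousLinearMap.mul ℂ C(X, ℂ) (charMap ψ⁻¹))
  have hΦ : ∀ f, Φ f = Λ (charMap ψ⁻¹ * f) := fun f => rfl
  have h0 : Φ = 0 := by
    refine continuousLinearMap_eq_zero_of_separatesPoints N ?_ ?_ Φ ?_
    · rintro _ ⟨χ, hχ, rfl⟩
      exact ⟨χ⁻¹, inv_mem hχ, (charMap_inv χ).symm⟩
    · intro x y hxy
      by_contra! H
      refine hxy (div_eq_one.1 (hL _ fun χ hχ => ?_))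
      rw [map_div, div_eq_one]
      exact Circle.ext (H _ ⟨χ, hχ, rfl⟩)
    · rintro _ ⟨χ, hχ, rfl⟩
      rw [hΦ, ← charMap_mul]
      refine invariant_mean_charMap hΛ fun h => hψ ?_
      rwa [← inv_mul_eq_one.1 h] at hχ
  have h1 : Φ (charMap ψ) = 1 := by
    rw [hΦ, ← charMap_mul, inv_mul_cancel, charMap_one, hΛ1]
  rw [h0] at h1
  simp at h1

/-- Every homomorphism from the dual group to the circle is the evaluation at a point. -/
theorem exists_forall_apply_eq (y : PontryaginDual X →* Circle) :
    ∃ x : X, ∀ χ : PontryaginDual X, χ x = y χ := by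
  obtain ⟨Λ, hΛ1, hΛ⟩ := exists_invariant_mean (X := X)
  by_contra! H
  -- `ι` maps `X` to a subgroup of a torus, and the range of `ι'` is its coset through `y`; if `y`
  -- is no evaluation, the two are disjoint and Urysohn's lemma separates them.
  let ι : C(X, PontryaginDual X → Circle) := ⟨fun x χ => χ x, by fun_prop⟩
  let ι' : C(X, PontryaginDual X → Circle) := ⟨fun x χ => y χ * χ x, by fun_prop⟩
  have hdisj : Disjoint (Set.range ι) (Set.range ι') := by
    rw [Set.disjoint_left]
    rintro _ ⟨x, rfl⟩ ⟨x', hx'⟩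
    obtain ⟨χ, hχ⟩ := H (x / x')
    have := congrFun hx' χ
    refine hχ ?_
    rw [map_div, div_eq_iff_eq_mul]
    exact this.symm
  obtain ⟨F, hF0, hF1, -⟩ := exists_continuous_zero_one_of_isClosed
    (isCompact_range ι.continuous).isClosed (isCompact_range ι'.continuous).isClosed hdisj
  let f : C(PontryaginDual X → Circle, ℂ) := ⟨fun z => (F z : ℂ), by fun_prop⟩
  -- The difference of the Haar means on the coset and on the subgroup. It vanishes on the functions
  -- in `N`, which restrict to characters, but not on the separating function.
  let Φ : C(PontryaginDual X → Circle, ℂ) →L[ℂ] ℂ :=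
    Λ.comp ⟨(ContinuousMap.compRightAlgHom ℂ ℂ ι').toLinearMap, ι'.continuous_precomp⟩ -
      Λ.comp ⟨(ContinuousMap.compRightAlgHom ℂ ℂ ι).toLinearMap, ι.continuous_precomp⟩
  have hΦ : ∀ g, Φ g = Λ (g.comp ι') - Λ (g.comp ι) := fun g => rfl
  let N : Submonoid C(PontryaginDual X → Circle, ℂ) :=
    { carrier := {g | ∃ χ, g.comp ι = charMap χ ∧ g.comp ι' = (y χ : ℂ) • charMap χ}
      one_mem' := ⟨1, rfl, by rw [map_one, Circle.coe_one, one_smul]; rfl⟩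
      mul_mem' := by
        rintro g g' ⟨χ, h1, h2⟩ ⟨ξ, h3, h4⟩
        refine ⟨χ * ξ, ?_, ?_⟩
        · rw [charMap_mul, ← h1, ← h3]; rfl
        · rw [charMap_mul, map_mul, Circle.coe_mul, ← smul_mul_smul_comm, ← h2, ← h4]; rfl }
  have h0 : Φ = 0 := by
    refine continuousLinearMap_eq_zero_of_separatesPoints N ?_ ?_ Φ ?_
    · rintro g ⟨χ, h1, h2⟩
      refine ⟨χ⁻¹, ?_, ?_⟩
      · rw [charMap_inv, ← h1]; rfl
      · rw [charMap_inv, map_inv, Circle.coe_inv_eq_conj, ← Complex.star_def, ← star_smul, ← h2]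
        rfl
    · intro z z' hz
      obtain ⟨χ, hχ⟩ := Function.ne_iff.1 hz
      refine ⟨⟨fun w => (w χ : ℂ), by fun_prop⟩, ⟨χ, rfl, ?_⟩, fun h => hχ (Circle.ext h)⟩
      ext x
      exact Circle.coe_mul _ _
    · rintro g ⟨χ, h1, h2⟩
      rw [hΦ, h1, h2, map_smul]
      by_cases hχ : χ = 1
      · rw [hχ, map_one, Circle.coe_one, one_smul, sub_self]
      · rw [invariant_mean_charMap hΛ hχ, smul_zero, sub_zero]
  have h1 : Φ f = 1 := by
    have hι : f.comp ι = 0 := by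
      ext x
      have := hF0 (Set.mem_range_self x)
      simp_all [f]
    have hι' : f.comp ι' = 1 := by
      ext x
      have := hF1 (Set.mem_range_self x)
      simp_all [f]
    rw [hΦ, hι, hι', hΛ1, map_zero, sub_zero]
  rw [h0] at h1
  simp at h1

/-- The neighbourhoods of the neutral element are described by finitely many characters. -/
theorem exists_finset_pontryaginDual_of_mem_nhds {N : Set X} (hN : N ∈ 𝓝 (1 : X)) :
    ∃ (F : Finset (PontryaginDual X)) (ε : ℝ), 0 < ε ∧
      ∀ x : X, (∀ χ ∈ F, dist (χ x) 1 < ε) → x ∈ N := by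
  classical
  -- These open sets cover the compact complement of the interior of `N`; a finite subcover supplies
  -- the characters and the smallest threshold.
  let U : PontryaginDual X × ℕ → Set X := fun p => {x | 1 / ((p.2 : ℝ) + 1) < dist (p.1 x) 1}
  have hU : ∀ p, IsOpen (U p) := fun p =>
    isOpen_lt continuous_const ((map_continuous p.1).dist continuous_const)
  obtain ⟨t, ht⟩ := (isOpen_interior (s := N)).isClosed_compl.isCompact.elim_finite_subcover U hU (by
    intro x hx
    have hx1 : x ≠ 1 := by
      rintro rfl
      exact hx (mem_interior_iff_mem_nhds.2 hN)
    obtain ⟨χ, hχ⟩ := exists_pontryaginDual_apply_ne_one hx1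
    obtain ⟨n, hn⟩ := exists_nat_one_div_lt (dist_pos.2 hχ)
    exact Set.mem_iUnion.2 ⟨(χ, n), hn⟩)
  refine ⟨t.image Prod.fst, 1 / (((t.sup Prod.snd : ℕ) : ℝ) + 1), by positivity, fun x hx => ?_⟩
  by_contra hxN
  obtain ⟨p, hp, hpx⟩ := Set.mem_iUnion₂.1 (ht fun h => hxN (interior_subset h))
  have h1 := hx p.1 (Finset.mem_image_of_mem _ hp)
  have h2 : 1 / ((p.2 : ℝ) + 1) < dist (p.1 x) 1 := hpx
  have h3 : (p.2 : ℝ) ≤ (t.sup Prod.snd : ℕ) := by exact_mod_cast Finset.le_sup (f := Prod.snd) hp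
  have h4 : 1 / (((t.sup Prod.snd : ℕ) : ℝ) + 1) ≤ 1 / ((p.2 : ℝ) + 1) := by gcongr
  linarith

end Duality

/-! ### Ideals of the group ring acting on bounded functions. -/

section GroupRing

variable {G : Type*} [CommGroup G]

/-- Given an ideal of the group ring of an abelian group that acts on a Banach space by uniformly
bounded operators, either some unitary point lies on the ideal, or the image of the ideal generates
the unit left ideal. -/
theorem exists_unitary_ringHom_or_span_eq_top {B : Type*} [NormedRing B] [NormedAlgebra ℂ B]
    [CompleteSpace B] (T : G →* B) {K : ℝ} (hT : ∀ g, ‖T g‖ ≤ K)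
    (J : Ideal (MonoidAlgebra ℤ G)) :
    (∃ φ : MonoidAlgebra ℤ G →+* ℂ, (∀ g, ‖φ (MonoidAlgebra.of ℤ G g)‖ = 1) ∧ J ≤ RingHom.ker φ) ∨
      Ideal.span (MonoidAlgebra.lift ℤ B G T '' (J : Set (MonoidAlgebra ℤ G))) = ⊤ := by
  have hs : ∀ a ∈ Set.range T, ∀ b ∈ Set.range T, a * b = b * a := by
    rintro _ ⟨g, rfl⟩ _ ⟨h, rfl⟩
    rw [← map_mul, mul_comm, map_mul]
  refine (exists_isBoundedCharacterOn_or_span_eq_top (t := MonoidAlgebra.lift ℤ B G T '' J) hs).imp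
    ?_ id
  rintro ⟨χ, hχ, hJ⟩
  have hmem : ∀ f, MonoidAlgebra.lift ℤ B G T f ∈ Algebra.adjoin ℂ (Set.range T) := by
    intro f
    induction f using MonoidAlgebra.induction_on with
    | of g =>
      rw [MonoidAlgebra.lift_of]
      exact Algebra.subset_adjoin ⟨g, rfl⟩
    | add a b ha hb =>
      rw [map_add]
      exact add_mem ha hb
    | smul r a ha =>
      rw [map_smul]
      exact zsmul_mem ha r
  obtain ⟨C, hC⟩ := hχ.exists_bound
  let φ : MonoidAlgebra ℤ G →+* ℂ := RingHom.mk'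
    { toFun := fun f => χ (MonoidAlgebra.lift ℤ B G T f)
      map_one' := by rw [map_one, hχ.map_one]
      map_mul' := fun a b => by rw [map_mul, hχ.map_mul _ (hmem a) _ (hmem b)] }
    fun a b => by
      change χ _ = χ _ + χ _
      rw [map_add, hχ.map_add _ (hmem a) _ (hmem b)]
  have hφ : ∀ f, φ f = χ (MonoidAlgebra.lift ℤ B G T f) := fun f => rfl
  have hle : ∀ g, ‖φ (MonoidAlgebra.of ℤ G g)‖ ≤ 1 := by
    -- All powers of `g` have images bounded by `|C| * K`, so none has modulus above `1`; the same
    -- bound for `g⁻¹` gives equality.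
    intro g
    by_contra! h
    obtain ⟨n, hn⟩ := pow_unbounded_of_one_lt (|C| * K) h
    rw [← norm_pow, ← map_pow, ← map_pow, hφ] at hn
    refine absurd hn (not_lt.2 ((hC _ (hmem _)).trans ?_))
    rw [MonoidAlgebra.lift_of]
    exact mul_le_mul (le_abs_self C) (hT _) (norm_nonneg _) (abs_nonneg C)
  refine ⟨φ, fun g => le_antisymm (hle g) ?_, fun f hf => hJ _ (hmem f) ⟨f, hf, rfl⟩⟩
  have h2 : ‖φ (MonoidAlgebra.of ℤ G g)‖ * ‖φ (MonoidAlgebra.of ℤ G g⁻¹)‖ = 1 := by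
    rw [← norm_mul, ← map_mul, ← map_mul, mul_inv_cancel, map_one, map_one, norm_one]
  calc 1 = ‖φ (MonoidAlgebra.of ℤ G g)‖ * ‖φ (MonoidAlgebra.of ℤ G g⁻¹)‖ := h2.symm
    _ ≤ ‖φ (MonoidAlgebra.of ℤ G g)‖ * 1 := mul_le_mul_of_nonneg_left (hle _) (norm_nonneg _)
    _ = _ := mul_one _

open BoundedContinuousFunction

/-- The translation of bounded functions by an element of a discrete abelian group, as a linear
map. -/
noncomputable def translationLinearMap [TopologicalSpace G] [DiscreteTopology G] (g : G) :
    (G →ᵇ ℂ) →ₗ[ℂ] (G →ᵇ ℂ) where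
  toFun u := u.compContinuous ⟨fun h => g * h, continuous_of_discreteTopology⟩
  map_add' _ _ := rfl
  map_smul' _ _ := rfl

theorem norm_translationLinearMap_le [TopologicalSpace G] [DiscreteTopology G] (g : G)
    (u : G →ᵇ ℂ) : ‖translationLinearMap g u‖ ≤ 1 * ‖u‖ := by
  rw [one_mul]
  exact (BoundedContinuousFunction.norm_le (norm_nonneg u)).2 fun h => u.norm_coe_le_norm (g * h)

/-- The translation operators on the space of bounded functions on a discrete abelian group. -/
noncomputable def translationOp [TopologicalSpace G] [DiscreteTopology G] :
    G →* ((G →ᵇ ℂ) →L[ℂ] (G →ᵇ ℂ)) where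
  toFun g := LinearMap.mkContinuous (translationLinearMap g) 1 (norm_translationLinearMap_le g)
  map_one' := by
    ext u h
    exact congrArg u (one_mul h)
  map_mul' g g' := by
    ext u h
    refine congrArg u (?_ : g * g' * h = g' * (g * h))
    rw [mul_comm g, mul_assoc]

theorem translationOp_apply [TopologicalSpace G] [DiscreteTopology G] (g : G) (u : G →ᵇ ℂ) (h : G) :
    translationOp g u h = u (g * h) := rfl

theorem norm_translationOp_le [TopologicalSpace G] [DiscreteTopology G] (g : G) :
    ‖translationOp g‖ ≤ 1 :=
  LinearMap.mkContinuous_norm_le _ zero_le_one (norm_translationLinearMap_le g)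

theorem lift_translationOp_apply [TopologicalSpace G] [DiscreteTopology G] (f : MonoidAlgebra ℤ G)
    (u : G →ᵇ ℂ) (h : G) :
    MonoidAlgebra.lift ℤ ((G →ᵇ ℂ) →L[ℂ] (G →ᵇ ℂ)) G translationOp f u h =
      f.coeff.sum fun g n => (n : ℂ) * u (g * h) := by
  induction f using MonoidAlgebra.induction_linear with
  | zero => simp
  | add a b ha hb =>
    rw [map_add, _root_.add_apply, BoundedContinuousFunction.add_apply, ha, hb,
      MonoidAlgebra.coeff_add,
      Finsupp.sum_add_index' (by simp) (by intros; push_cast; ring)]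
  | single g n =>
    rw [MonoidAlgebra.lift_single, MonoidAlgebra.coeff_single, Finsupp.sum_single_index (by simp)]
    simp [translationOp_apply]

/-- If no unitary point lies on an ideal `J` of the group ring, then finitely many elements of `J`
have no common zero in the space of bounded complex functions. -/
theorem exists_finset_injective (J : Ideal (MonoidAlgebra ℤ G))
    (hJ : ¬ ∃ φ : MonoidAlgebra ℤ G →+* ℂ,
      (∀ g, ‖φ (MonoidAlgebra.of ℤ G g)‖ = 1) ∧ J ≤ RingHom.ker φ) :
    ∃ F : Finset (MonoidAlgebra ℤ G), (F : Set (MonoidAlgebra ℤ G)) ⊆ J ∧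
      ∀ u : G → ℂ, (∃ C, ∀ g, ‖u g‖ ≤ C) →
        (∀ f ∈ F, ∀ h, (f.coeff.sum fun g n => (n : ℂ) * u (g * h)) = 0) → u = 0 := by
  classical
  let _ : TopologicalSpace G := ⊥
  have : DiscreteTopology G := ⟨rfl⟩
  have hspan := (exists_unitary_ringHom_or_span_eq_top
    (B := (G →ᵇ ℂ) →L[ℂ] (G →ᵇ ℂ)) translationOp norm_translationOp_le J).resolve_left hJ
  have h1 := (Ideal.eq_top_iff_one _).1 hspan
  obtain ⟨F', hF', hF1⟩ := Submodule.mem_span_finite_of_mem_span h1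
  obtain ⟨F, hF, rfl⟩ := Finset.subset_set_image_iff.1 hF'
  refine ⟨F, hF, fun u ⟨C, hC⟩ hu => ?_⟩
  let v : G →ᵇ ℂ := BoundedContinuousFunction.ofNormedAddCommGroup u
    continuous_of_discreteTopology C hC
  -- Every element of the left ideal generated by `F` kills `v`, since `F` is applied first; this
  -- ideal contains `1`.
  have hv : ∀ b ∈ Submodule.span ((G →ᵇ ℂ) →L[ℂ] (G →ᵇ ℂ))
      ((F.image (MonoidAlgebra.lift ℤ ((G →ᵇ ℂ) →L[ℂ] (G →ᵇ ℂ)) G translationOp) : Finset _) :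
        Set ((G →ᵇ ℂ) →L[ℂ] (G →ᵇ ℂ))), b v = 0 := by
    intro b hb
    induction hb using Submodule.span_induction with
    | mem b hb =>
      obtain ⟨f, hf, rfl⟩ := Finset.mem_image.1 (Finset.mem_coe.1 hb)
      ext h
      rw [lift_translationOp_apply]
      exact hu f hf h
    | zero => rfl
    | add a b _ _ ha hb => rw [_root_.add_apply, ha, hb, add_zero]
    | smul a b _ hb => rw [smul_eq_mul, mul_apply_eq_comp, hb, map_zero]
  have h0 : v = 0 := hv 1 hF1
  funext g
  exact DFunLike.congr_fun h0 g

end GroupRing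

/-! ### Supports of finite modules. -/

section Support

open TensorProduct

variable {R M K : Type*} [CommRing R] [AddCommGroup M] [Module R M] [Field K]

/-- A homomorphism from a ring to a field that vanishes on the annihilator of an element of a
finite module `M` is the multiplier of a nonzero additive map from `M` to the field. -/
theorem exists_equivariant_addMonoidHom [Module.Finite R M] (φ : R →+* K) {a : M}
    (ha : Ideal.torsionOf R M a ≤ RingHom.ker φ) :
    ∃ h : M →+ K, (∃ m, h m ≠ 0) ∧ ∀ (r : R) m, h (r • m) = φ r * h m := by
  obtain ⟨p, hpφ⟩ : ∃ p : PrimeSpectrum R, p.asIdeal = RingHom.ker φ :=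
    ⟨⟨RingHom.ker φ, RingHom.ker_isPrime φ⟩, rfl⟩
  have hp : p ∈ Module.support R M := by
    refine Module.mem_support_iff'.2 ⟨a, fun r hr h0 => hr ?_⟩
    rw [hpφ]
    exact ha ((Ideal.mem_torsionOf_iff a r).2 h0)
  -- Nakayama's lemma: at a prime of the support, the fibre of a finite module is nonzero. A
  -- functional on the fibre, followed by the embedding of the residue field into `K`, gives the
  -- map.
  have := (Module.mem_support_iff_nontrivial_residueField_tensorProduct p).1 hp
  obtain ⟨m, hm⟩ : ∃ m : M, (1 : p.asIdeal.ResidueField) ⊗ₜ[R] m ≠ 0 := by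
    by_contra! H
    obtain ⟨z, hz⟩ := exists_ne (0 : p.asIdeal.ResidueField ⊗[R] M)
    refine hz ?_
    induction z using TensorProduct.induction_on with
    | zero => rfl
    | tmul x m =>
      have : x ⊗ₜ[R] m = x • ((1 : p.asIdeal.ResidueField) ⊗ₜ[R] m) := by
        rw [TensorProduct.smul_tmul', smul_eq_mul, mul_one]
      rw [this, H, smul_zero]
    | add x y hx hy =>
      by_cases hx0 : x = 0
      · by_cases hy0 : y = 0
        · rw [hx0, hy0, add_zero]
        · exact absurd (hy hy0) hy0
      · exact absurd (hx hx0) hx0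
  obtain ⟨ℓ, hℓ⟩ : ∃ ℓ : Module.Dual p.asIdeal.ResidueField (p.asIdeal.ResidueField ⊗[R] M),
      ℓ (1 ⊗ₜ m) ≠ 0 := by
    by_contra! H
    exact hm ((Module.forall_dual_apply_eq_zero_iff _ _).1 H)
  let ψ : p.asIdeal.ResidueField →+* K := Ideal.ResidueField.lift p.asIdeal φ hpφ.le
    fun r hr => IsUnit.mk0 _ fun h0 => hr (hpφ ▸ h0)
  refine ⟨ψ.toAddMonoidHom.comp (ℓ.toAddMonoidHom.comp
    (TensorProduct.mk R p.asIdeal.ResidueField M 1).toAddMonoidHom), ⟨m, ?_⟩, fun r m => ?_⟩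
  · exact (map_ne_zero ψ).2 hℓ
  · change ψ (ℓ (1 ⊗ₜ (r • m))) = φ r * ψ (ℓ (1 ⊗ₜ m))
    have h1 : (1 : p.asIdeal.ResidueField) ⊗ₜ[R] (r • m) =
        algebraMap R p.asIdeal.ResidueField r • ((1 : p.asIdeal.ResidueField) ⊗ₜ[R] m) := by
      rw [TensorProduct.tmul_smul, algebraMap_smul]
    have h2 : ψ (algebraMap R p.asIdeal.ResidueField r) = φ r :=
      Ideal.ResidueField.lift_algebraMap _ _ _ _ _
    rw [h1, map_smul, smul_eq_mul, map_mul, h2]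

/-- A homomorphism from a ring to a field that vanishes on the annihilator of a finite module
vanishes on the annihilator of an element of any given generating set. -/
theorem exists_torsionOf_le_ker [Module.Finite R M] {S : Set M} (hS : Submodule.span R S = ⊤)
    (φ : R →+* K) (hφ : Module.annihilator R M ≤ RingHom.ker φ) :
    ∃ a ∈ S, Ideal.torsionOf R M a ≤ RingHom.ker φ := by
  obtain ⟨p, hpφ⟩ : ∃ p : PrimeSpectrum R, p.asIdeal = RingHom.ker φ :=
    ⟨⟨RingHom.ker φ, RingHom.ker_isPrime φ⟩, rfl⟩
  rw [← hpφ] at hφ ⊢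
  -- Two descriptions of the support are compared: the zero locus of the annihilator, as `M` is
  -- finite, and the union of the loci of the `ann(a)` for generators `a`.
  obtain ⟨a, ha, hle⟩ := (Module.mem_support_iff_of_span_eq_top hS).1
    (Module.mem_support_iff_of_finite.2 hφ)
  refine ⟨a, ha, fun r hr => hle ?_⟩
  rwa [Submodule.mem_annihilator_span_singleton, ← Ideal.mem_torsionOf_iff]

end Support

/-! ### Unitary points as homomorphisms on the group ring. -/

section Points

variable {G : Type*} [CommGroup G]

/-- Unitary points of a quotient of the group ring are the homomorphisms on the group ring that
vanish on the ideal and are of modulus one on the group. -/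
theorem hasUnitaryPoint_iff (I : Ideal (MonoidAlgebra ℤ G)) :
    HasUnitaryPoint I ↔ ∃ φ : MonoidAlgebra ℤ G →+* ℂ,
      (∀ g, ‖φ (MonoidAlgebra.of ℤ G g)‖ = 1) ∧ I ≤ RingHom.ker φ := by
  constructor
  · rintro ⟨φ, H, hH⟩
    refine ⟨φ.comp (Ideal.Quotient.mk I), fun g => ?_, fun f hf => ?_⟩
    · have hmem : φ (Ideal.Quotient.mk I (MonoidAlgebra.of ℤ G g)) ∈ φ '' groupImage I :=
        ⟨_, ⟨g, rfl⟩, rfl⟩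
      rw [hH] at hmem
      obtain ⟨z, -, hz⟩ := hmem
      rw [RingHom.comp_apply, ← hz]
      exact Circle.norm_coe z
    · rw [RingHom.mem_ker, RingHom.comp_apply, Ideal.Quotient.eq_zero_iff_mem.2 hf, map_zero]
  · rintro ⟨φ, hφ, hI⟩
    let ξ : G →* Circle :=
      { toFun := fun g => ⟨φ (MonoidAlgebra.of ℤ G g), mem_sphere_zero_iff_norm.2 (hφ g)⟩
        map_one' := Subtype.ext (by
          change φ _ = 1
          rw [map_one, map_one])
        map_mul' := fun g h => Subtype.ext (by
          change φ _ = φ _ * φ _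
          rw [map_mul, map_mul]) }
    refine ⟨Ideal.Quotient.lift I φ fun f hf => hI hf, ξ.range, ?_⟩
    ext z
    constructor
    · rintro ⟨_, ⟨g, rfl⟩, rfl⟩
      exact ⟨ξ g, ⟨g, rfl⟩, (Ideal.Quotient.lift_mk I φ _).symm⟩
    · rintro ⟨_, ⟨g, rfl⟩, rfl⟩
      exact ⟨_, ⟨g, rfl⟩, Ideal.Quotient.lift_mk I φ _⟩

end Points

/-! ### Pairing of the dual module with `X`. -/

section Evaluation

variable {G X : Type*} [CommGroup G] [CommGroup X] [TopologicalSpace X]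
  [MulDistribMulAction G X] [ContinuousConstSMul G X]

/-- The value of an element of the dual module at a point. -/
noncomputable def eval (a : DualModule G X) (x : X) : Circle :=
  (Additive.toMul (Representation.asModuleEquiv (dualRep G X) a) : PontryaginDual X) x

/-- The element of the dual module given by a character. -/
noncomputable def ofDual : Additive (PontryaginDual X) ≃+ DualModule G X :=
  (Representation.asModuleEquiv (dualRep G X)).symm.toAddEquiv

theorem continuous_eval (a : DualModule G X) : Continuous (eval a) :=
  map_continuous (Additive.toMul (Representation.asModuleEquiv (dualRep G X) a) : PontryaginDual X)

theorem eval_one (a : DualModule G X) : eval a 1 = 1 :=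
  map_one (Additive.toMul (Representation.asModuleEquiv (dualRep G X) a) : PontryaginDual X)

theorem eval_zero (x : X) : eval (0 : DualModule G X) x = 1 := rfl

theorem eval_add (a b : DualModule G X) (x : X) : eval (a + b) x = eval a x * eval b x := rfl

theorem eval_single_smul (g : G) (n : ℤ) (a : DualModule G X) (x : X) :
    eval (MonoidAlgebra.single g n • a) x = eval a (g • x) ^ n := by
  rw [Representation.single_smul]
  let e : PontryaginDual X →* Circle := ⟨⟨fun χ => χ x, rfl⟩, fun _ _ => rfl⟩
  exact map_zpow e (Additive.toMul (dualRep G X g (Representation.asModuleEquiv _ a))) n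

theorem eval_of_smul (g : G) (a : DualModule G X) (x : X) :
    eval (MonoidAlgebra.of ℤ G g • a) x = eval a (g • x) := by
  rw [MonoidAlgebra.of_apply, eval_single_smul, zpow_one]

/-- Once logarithms `θ` of the orbit values are chosen, the action of `f` becomes a real linear
expression in the exponent. -/
theorem eval_smul_eq_exp (f : MonoidAlgebra ℤ G) (a : DualModule G X) (x : X) {θ : G → ℝ}
    (hθ : ∀ g, eval a (g • x) = Circle.exp (θ g)) :
    eval (f • a) x = Circle.exp (f.coeff.sum fun g n => (n : ℝ) * θ g) := by
  induction f using MonoidAlgebra.induction_linear with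
  | zero => simp [eval_zero]
  | add f f' hf hf' =>
    rw [add_smul, eval_add, hf, hf', ← Circle.exp_add, MonoidAlgebra.coeff_add,
      Finsupp.sum_add_index' (by simp) (by intros; push_cast; ring)]
  | single g n =>
    rw [eval_single_smul, hθ, MonoidAlgebra.coeff_single, Finsupp.sum_single_index (by simp),
      ← zsmul_eq_mul, Circle.exp_zsmul]

theorem eval_eq_one_of_mem_span {F : Set (DualModule G X)} {x : X}
    (hx : ∀ a ∈ F, ∀ g : G, eval a (g • x) = 1) {b : DualModule G X}
    (hb : b ∈ Submodule.span (MonoidAlgebra ℤ G) F) : eval b x = 1 := by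
  -- The scalar step of the induction needs the values along the whole orbit.
  suffices h : ∀ g : G, eval b (g • x) = 1 by simpa using h 1
  induction hb using Submodule.span_induction with
  | mem b hb => exact hx b hb
  | zero => exact fun g => eval_zero _
  | add a b _ _ ha hb => exact fun g => by rw [eval_add, ha, hb, mul_one]
  | smul f a _ ha =>
    intro g
    rw [eval_smul_eq_exp f a (g • x) (θ := 0) fun h => by
      rw [smul_smul, ha, Pi.zero_apply, Circle.exp_zero]]
    simp

end Evaluation

/-! ### Consequences of expansiveness. -/

section Expansiveness

variable {G X : Type*} [CommGroup G] [CommGroup X] [TopologicalSpace X] [IsTopologicalGroup X]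
  [CompactSpace X] [T2Space X] [SecondCountableTopology X]
  [MulDistribMulAction G X] [ContinuousConstSMul G X]

theorem eq_one_of_forall_eval_eq_one {x : X} (hx : ∀ a : DualModule G X, eval a x = 1) : x = 1 := by
  by_contra h
  obtain ⟨χ, hχ⟩ := exists_pontryaginDual_apply_ne_one h
  exact hχ (hx (ofDual (Additive.ofMul χ)))

theorem exists_eval_eq (y : Multiplicative (DualModule G X) →* Circle) :
    ∃ x : X, ∀ a : DualModule G X, eval a x = y (Multiplicative.ofAdd a) := by
  obtain ⟨x, hx⟩ := exists_forall_apply_eq (X := X)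
    ⟨⟨fun χ => y (Multiplicative.ofAdd (ofDual (Additive.ofMul χ))), by
      rw [ofMul_one, map_zero, ofAdd_zero, map_one]⟩, fun χ ξ =>
      map_mul y (Multiplicative.ofAdd (ofDual (Additive.ofMul χ)))
        (Multiplicative.ofAdd (ofDual (Additive.ofMul ξ)))⟩
  exact ⟨x, fun a => hx _⟩

/-- Expansiveness in terms of finitely many characters. -/
theorem isExpansive_iff : IsExpansive G X ↔ ∃ (F : Finset (DualModule G X)) (ε : ℝ), 0 < ε ∧
    ∀ x : X, (∀ a ∈ F, ∀ g : G, dist (eval a (g • x)) 1 < ε) → x = 1 := by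
  classical
  constructor
  · rintro ⟨N, hN, h⟩
    obtain ⟨F, ε, hε, hF⟩ := exists_finset_pontryaginDual_of_mem_nhds hN
    refine ⟨F.image fun χ => ofDual (Additive.ofMul χ), ε, hε, fun x hx => ?_⟩
    have hmem : x ∈ ⋂ g : G, (fun x : X => g • x) '' N := by
      refine Set.mem_iInter.2 fun g => ⟨g⁻¹ • x, hF _ fun χ hχ => ?_, smul_inv_smul g x⟩
      exact hx _ (Finset.mem_image_of_mem _ hχ) g⁻¹
    rwa [h] at hmem
  · rintro ⟨F, ε, hε, h⟩
    refine ⟨⋂ a ∈ F, {x | dist (eval a x) 1 < ε}, ?_, ?_⟩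
    · refine (Filter.biInter_finset_mem F).2 fun a _ => ?_
      refine IsOpen.mem_nhds (isOpen_lt ((continuous_eval a).dist continuous_const)
        continuous_const) ?_
      simpa [eval_one] using hε
    · refine Set.eq_singleton_iff_unique_mem.2 ⟨Set.mem_iInter.2 fun g => ⟨1, ?_, smul_one g⟩,
        fun x hx => h x fun a ha g => ?_⟩
      · simpa [eval_one] using fun _ _ => hε
      · obtain ⟨y, hy, hxy⟩ := Set.mem_iInter.1 hx g⁻¹
        have : g • x = y := by rw [← hxy]; exact smul_inv_smul g y
        rw [this]
        exact Set.mem_iInter₂.1 hy a ha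

/-- A point killed by the submodule generated by `F` has its entire orbit killed by `F`, so it is
trivial; a separating group of characters is everything. -/
theorem IsExpansive.finite (h : IsExpansive G X) :
    Module.Finite (MonoidAlgebra ℤ G) (DualModule G X) := by
  obtain ⟨F, ε, hε, hF⟩ := isExpansive_iff.1 h
  let L := Submodule.span (MonoidAlgebra ℤ G) (F : Set (DualModule G X))
  let L' : Subgroup (PontryaginDual X) :=
    { carrier := {χ | ofDual (Additive.ofMul χ) ∈ L}
      one_mem' := L.zero_mem
      mul_mem' := fun h h' => L.add_mem h h'
      inv_mem' := fun {χ} h => by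
        change ofDual (Additive.ofMul χ⁻¹) ∈ L
        rw [ofMul_inv, map_neg]
        exact L.neg_mem h }
  have hL' : ∀ χ, χ ∈ L' := mem_of_separatesPoints L' fun x hx => by
    refine hF x fun a ha g => ?_
    have : eval (MonoidAlgebra.of ℤ G g • a) x = 1 :=
      hx (Additive.toMul (ofDual.symm (MonoidAlgebra.of ℤ G g • a)))
        (L.smul_mem _ (Submodule.subset_span ha))
    rw [← eval_of_smul, this, dist_self]
    exact hε
  exact ⟨⟨F, eq_top_iff.2 fun a _ => hL' (Additive.toMul (ofDual.symm a))⟩⟩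

theorem IsExpansive.not_hasUnitaryPoint (h : IsExpansive G X) (a : DualModule G X) :
    ¬ HasUnitaryPoint (Ideal.torsionOf (MonoidAlgebra ℤ G) (DualModule G X) a) := by
  rw [hasUnitaryPoint_iff]
  rintro ⟨φ, hφ, ha⟩
  have := h.finite
  obtain ⟨η, ⟨m, hm⟩, hη⟩ := exists_equivariant_addMonoidHom φ ha
  obtain ⟨F, ε, hε, hF⟩ := isExpansive_iff.1 h
  -- This rotation makes `w * η m = ‖η m‖ ^ 2` real and positive, so taking real parts does not lose
  -- it.
  let w := starRingEnd ℂ (η m)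
  obtain ⟨C, hC⟩ := (F.image fun b => ‖w * η b‖).exists_le
  let C' := max C ‖w * η m‖
  have hmC : 0 < ‖w * η m‖ := by simpa [w] using hm
  have hC' : 0 < C' := lt_max_of_lt_right hmC
  -- The bound `ε` keeps the orbit close to `1` along `F`; the bound `1` keeps the angle at `m`
  -- where `Circle.exp` is injective.
  let t := min ε 1 / (2 * C')
  have ht : 0 < t := by positivity
  have htC : t * C' = min ε 1 / 2 := by
    simp only [t]
    field_simp
  let y : Multiplicative (DualModule G X) →* Circle :=
    { toFun := fun b => Circle.exp (t * (w * η b.toAdd).re)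
      map_one' := by simp
      map_mul' := fun b c => by
        rw [← Circle.exp_add, toAdd_mul, map_add, mul_add, Complex.add_re, mul_add] }
  obtain ⟨x, hx⟩ := exists_eval_eq y
  have hx1 : x = 1 := by
    refine hF x fun b hb g => ?_
    rw [← eval_of_smul, hx]
    change dist (Circle.exp (t * (w * η (MonoidAlgebra.of ℤ G g • b)).re)) 1 < ε
    have h1 : dist (Circle.exp (t * (w * η (MonoidAlgebra.of ℤ G g • b)).re)) 1 ≤
        |t * (w * η (MonoidAlgebra.of ℤ G g • b)).re| := by
      change dist ((Circle.exp _ : Circle) : ℂ) ((1 : Circle) : ℂ) ≤ _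
      rw [dist_eq_norm, Circle.coe_exp, Circle.coe_one, mul_comm _ Complex.I]
      exact Real.norm_exp_I_mul_ofReal_sub_one_le
    refine h1.trans_lt ?_
    rw [abs_mul, abs_of_pos ht]
    calc t * |(w * η (MonoidAlgebra.of ℤ G g • b)).re| ≤ t * C' := by
          refine mul_le_mul_of_nonneg_left ((Complex.abs_re_le_norm _).trans ?_) ht.le
          rw [hη, mul_left_comm, norm_mul, hφ, one_mul]
          exact (hC _ (Finset.mem_image_of_mem _ hb)).trans (le_max_left _ _)
      _ < ε := by
          rw [htC]
          linarith [min_le_left ε 1, lt_min hε one_pos]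
  have hm1 := hx m
  rw [hx1, eval_one] at hm1
  have hre : (w * η m).re = ‖w * η m‖ := by
    have : w * η m = ((‖η m‖ ^ 2 : ℝ) : ℂ) := by
      rw [Complex.conj_mul']
      push_cast
      rfl
    rw [this, Complex.ofReal_re, Complex.norm_real, Real.norm_of_nonneg (by positivity)]
  have hm2 : Circle.exp (t * ‖w * η m‖) = Circle.exp 0 := by
    rw [Circle.exp_zero, hm1, ← hre]
    rfl
  have hle : t * ‖w * η m‖ ≤ 1 := by
    calc t * ‖w * η m‖ ≤ t * C' := mul_le_mul_of_nonneg_left (le_max_right _ _) ht.le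
      _ ≤ 1 := by
        rw [htC]
        linarith [min_le_right ε 1]
  have hpos : 0 < t * ‖w * η m‖ := by positivity
  exact hpos.ne' (Circle.exp_injOn_Icc (a := 0) (b := 1) (by linarith [Real.pi_gt_three])
    ⟨hpos.le, hle⟩ ⟨le_rfl, zero_le_one⟩ hm2)

end Expansiveness

/-! ### Expansiveness from the absence of unitary points. -/

section Converse

variable {G X : Type*} [CommGroup G] [CommGroup X] [TopologicalSpace X] [IsTopologicalGroup X]
  [CompactSpace X] [T2Space X] [SecondCountableTopology X]
  [MulDistribMulAction G X] [ContinuousConstSMul G X]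

/-- The argument of a point of the circle close to `1` is small. -/
theorem exists_dist_lt_imp_abs_arg_lt {η : ℝ} (hη : 0 < η) :
    ∃ ε > 0, ∀ z : Circle, dist z 1 < ε → |Complex.arg z| < η := by
  have hc : ContinuousAt (fun z : Circle => Complex.arg z) 1 :=
    (Complex.continuousAt_arg (by simp [Complex.one_mem_slitPlane])).comp
      continuous_subtype_val.continuousAt
  obtain ⟨ε, hε, h⟩ := Metric.continuousAt_iff.1 hc η hη
  refine ⟨ε, hε, fun z hz => ?_⟩
  simpa [Real.dist_eq] using h hz

/-- If the orbit of a point under the group is close to the neutral element in the direction `a`,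
then its arguments in this direction are annihilated by the annihilator of `a`. -/
theorem sum_mul_arg_eval_eq_zero {f : MonoidAlgebra ℤ G} {a : DualModule G X} (hf : f • a = 0)
    {x : X} {η : ℝ} (hx : ∀ g : G, |Complex.arg (eval a (g • x))| ≤ η)
    (hη : (f.coeff.sum fun _ n => |(n : ℝ)|) * η < 2 * Real.pi) (h : G) :
    (f.coeff.sum fun g n => (n : ℝ) * Complex.arg (eval a ((g * h) • x))) = 0 := by
  have h1 := eval_smul_eq_exp f a (h • x) (θ := fun g => Complex.arg (eval a ((g * h) • x)))
    fun g => by rw [Circle.exp_arg, mul_smul]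
  rw [hf, eval_zero] at h1
  have h2 : |f.coeff.sum fun g n => (n : ℝ) * Complex.arg (eval a ((g * h) • x))| <
      2 * Real.pi := by
    refine lt_of_le_of_lt ?_ hη
    rw [Finsupp.sum, Finsupp.sum, Finset.sum_mul]
    refine (Finset.abs_sum_le_sum_abs _ _).trans (Finset.sum_le_sum fun g _ => ?_)
    rw [abs_mul]
    exact mul_le_mul_of_nonneg_left (hx _) (abs_nonneg _)
  rw [abs_lt] at h2
  -- The sum is an integer multiple of `2π` of absolute value below `2π`, hence zero.
  obtain ⟨n, hn⟩ := Circle.exp_eq_exp.1 (h1.symm.trans Circle.exp_zero.symm)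
  rw [zero_add] at hn
  have hpi := Real.two_pi_pos
  have hn1 : (n : ℝ) < 1 := by
    by_contra! hcon
    nlinarith [h2.2]
  have hn2 : (-1 : ℝ) < n := by
    by_contra! hcon
    nlinarith [h2.1]
  have hn0 : n = 0 := by
    have h3 : n < 1 := by exact_mod_cast hn1
    have h4 : -1 < n := by exact_mod_cast hn2
    omega
  rw [hn, hn0, Int.cast_zero, zero_mul]

/-- An action with finitely generated dual module is expansive if no unitary point lies on the
annihilator of the dual module. -/
theorem isExpansive_of_not_exists_unitary
    [Module.Finite (MonoidAlgebra ℤ G) (DualModule G X)]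
    (hJ : ¬ ∃ φ : MonoidAlgebra ℤ G →+* ℂ, (∀ g, ‖φ (MonoidAlgebra.of ℤ G g)‖ = 1) ∧
      Module.annihilator (MonoidAlgebra ℤ G) (DualModule G X) ≤ RingHom.ker φ) :
    IsExpansive G X := by
  classical
  obtain ⟨F, hF⟩ := Module.Finite.fg_top (R := MonoidAlgebra ℤ G) (M := DualModule G X)
  obtain ⟨E, hE, hinj⟩ := exists_finset_injective _ hJ
  -- `K` bounds the ℓ¹ norms of the finitely many relations in `E`, so arguments of size at most
  -- `(|K| + 1)⁻¹` give sums of size at most `1 < 2π`.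
  obtain ⟨K, hK⟩ := (E.image fun f => f.coeff.sum fun _ n => |(n : ℝ)|).exists_le
  have hK' : 0 < |K| + 1 := by positivity
  obtain ⟨ε, hε, harg⟩ := exists_dist_lt_imp_abs_arg_lt (inv_pos.2 hK')
  refine isExpansive_iff.2 ⟨F, ε, hε, fun x hx => ?_⟩
  have hone : ∀ a ∈ F, ∀ g : G, eval a (g • x) = 1 := by
    intro a ha
    have hbound : ∀ g : G, |Complex.arg (eval a (g • x))| ≤ (|K| + 1)⁻¹ := fun g =>
      (harg _ (hx a ha g)).le
    have hzero := hinj (fun g => ((Complex.arg (eval a (g • x)) : ℝ) : ℂ))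
      ⟨(|K| + 1)⁻¹, fun g => by
        rw [Complex.norm_real]
        exact hbound g⟩ fun f hf h => by
        have h1 := sum_mul_arg_eval_eq_zero (Module.mem_annihilator.1 (hE hf) a) hbound (by
          have h2 : (f.coeff.sum fun _ n => |(n : ℝ)|) ≤ |K| :=
            (hK _ (Finset.mem_image_of_mem _ hf)).trans (le_abs_self K)
          calc (f.coeff.sum fun _ n => |(n : ℝ)|) * (|K| + 1)⁻¹ ≤ (|K| + 1) * (|K| + 1)⁻¹ := by
                gcongr
                linarith
            _ = 1 := mul_inv_cancel₀ hK'.ne'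
            _ < 2 * Real.pi := by linarith [Real.pi_gt_three]) h
        have h2 := congrArg (fun r : ℝ => (r : ℂ)) h1
        simpa [Finsupp.sum] using h2
    intro g
    have h3 : Complex.arg (eval a (g • x)) = 0 := Complex.ofReal_eq_zero.1 (congrFun hzero g)
    rw [← Circle.exp_arg (eval a (g • x)), h3, Circle.exp_zero]
  refine eq_one_of_forall_eval_eq_one (G := G) fun b => eval_eq_one_of_mem_span hone ?_
  rw [hF]
  trivial

end Converse

end AlgebraicAction

theorem mainTheorem1 {G X : Type*} [CommGroup G] [Countable G]
    [CommGroup X] [TopologicalSpace X] [IsTopologicalGroup X] [CompactSpace X]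
    [TopologicalSpace.MetrizableSpace X]
    [MulDistribMulAction G X] [ContinuousConstSMul G X]
    (S : Set (AlgebraicAction.DualModule G X))
    (hS : Submodule.span (MonoidAlgebra ℤ G) S = ⊤) :
    AlgebraicAction.IsExpansive G X ↔
      Module.Finite (MonoidAlgebra ℤ G) (AlgebraicAction.DualModule G X) ∧
        ∀ a ∈ S, ¬ AlgebraicAction.HasUnitaryPoint
          (Ideal.torsionOf (MonoidAlgebra ℤ G) (AlgebraicAction.DualModule G X) a) := by
  have : SecondCountableTopology X := by
    let _ := TopologicalSpace.metrizableSpaceMetric X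
    infer_instance
  refine ⟨fun h => ⟨h.finite, fun a _ => h.not_hasUnitaryPoint a⟩, fun ⟨hfin, h⟩ => ?_⟩
  refine AlgebraicAction.isExpansive_of_not_exists_unitary ?_
  rintro ⟨φ, hφ, hann⟩
  obtain ⟨a, ha, hle⟩ := AlgebraicAction.exists_torsionOf_le_ker hS φ hann
  exact h a ha ((AlgebraicAction.hasUnitaryPoint_iff _).2 ⟨φ, hφ, hle⟩)
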